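/- **Theorem (symmetric implies primitive).** Let $n\ge 0$, $N=2^n$, and let $G_N=G_2^{\otimes n}$ be the $n$-fold Kronecker power over $\mathbb F_2$ of $G_2=\begin{bmatrix}1&0\\1&1\end{bmatrix}$. A *puncturing pattern* is a vector $P=(P(0),\dots,P(N-1))\in\{0,1\}^N$. *Erasure pattern.* Let $W$ be a binary-input memoryless channel, i.e. a pair of probability measures $W(\cdot\mid 0),W(\cdot\mid 1)$ on an arbitrary measurable space $\mathcal Y$ (in particular, any B-DMC), with symmetric capacity (mutual information between a uniform input and the output) $\mathcal I(W)>0$. A data vector $u\in\mathbb F_2^N$ is encoded as $x=u\cdot G_N$ and sent over $W$; the received symbol at position $j$ is an additional erasure symbol $\star\notin\mathcal Y$ if $P(j)=1$, and is the output of $W$ with input $x_j$ if $P(j)=0$; this gives the received sequence $y[P]\in(\mathcal Y\cup\{\star\})^N$. For $0\le i<N$ let $W[P]^{(i)}_N$ be the virtual channel with input $u_i$ and output $(y[P],u_0,\dots,u_{i-1})$, where the data bits other than $u_i$ are independent and uniform. The erasure pattern $E[P]\in\{0,1\}^N$ is defined by $E[P](i)=1$ if and only if $\mathcal I(W[P]^{(i)}_N)=0$.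 The pattern $P$ is *symmetric* (with respect to $W$) if $E[P]=P$. *Primitive patterns.* For a map $f$ of $\{0,\dots,N-1\}$ to itself and a pattern $A$, let $f(A)(i)=A(f(i))$. Let $B_N$ be the bit-reversal permutation of $\{0,\dots,N-1\}$. For $0\le j<n$ and $k\in\{0,2^{j+1},2\cdot 2^{j+1},\dots,N-2^{j+1}\}$, let the elementary permutation $\phi_{k,j}$ swap the blocks $[k,\dots,k+2^j-1]$ and $[k+2^j,\dots,k+2^{j+1}-1]$ (keeping the order inside each block) and fix all other positions. Patterns $P,P'$ are *equivalent*, $P\approx P'$, if $P'=B_N(\phi_{k_t,j_t}(\cdots\phi_{k_1,j_1}(B_N(P))\cdots))$ for some finite (possibly empty) sequence of elementary permutations. Let $\phi(A)$ be the result of the following procedure: for $j=0,1,\dots,n-1$, and for each $j$ successively for $k=0,2^{j+1},\dots,N-2^{j+1}$, replace the current pattern $A$ by $\phi_{k,j}(A)$ if $[A(k),\dots,A(k+2^j-1)]<_{lex}[A(k+2^j),\dots,A(k+2^{j+1}-1)]$, and leave it unchanged otherwise. Put $\Phi(P)=B_N(\phi(B_N(P)))$, and call $P$ *primitive* if $\Phi(P)=P$.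 *Claim.* Every symmetric puncturing pattern $P$ is primitive, that is, $\Phi(P)=P$; and $P$ is the primitive pattern of its equivalence class, that is, every primitive pattern $P'\approx P$ is equal to $P$. -/

import Mathlib

open MeasureTheory

open scoped ENNReal Kronecker Matrix

namespace PolarCode

/-- A puncturing pattern of length `N = 2 ^ n`: position `i` is punctured iff the value is `true`. -/
abbrev Pattern (n : ℕ) : Type := Fin (2 ^ n) → Bool

/-! ### The generator matrix -/

/-- The kernel matrix `G₂` over the field with two elements. -/
def kernelMatrix : Matrix (Fin 2) (Fin 2) (ZMod 2) := !![1, 0; 1, 1]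

/-- The generator matrix `G_N = G₂ ⊗ ⋯ ⊗ G₂` (`n` factors), with `N = 2 ^ n`. The pair of indices
`(a, r)` of the Kronecker product `G₂ ⊗ G_{N/2}` is the index `a * (N/2) + r`. -/
def genMatrix : (n : ℕ) → Matrix (Fin (2 ^ n)) (Fin (2 ^ n)) (ZMod 2)
  | 0 => 1
  | n + 1 =>
    Matrix.reindex (finProdFinEquiv.trans (finCongr (pow_succ' 2 n).symm))
      (finProdFinEquiv.trans (finCongr (pow_succ' 2 n).symm))
      (kernelMatrix ⊗ₖ genMatrix n)

/-! ### Punctured transmission, virtual channels, erasure pattern -/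

section Channel

variable {Y : Type*} [MeasurableSpace Y]

/-- The symmetric capacity, in bits, of the binary-input channel `W` with transition laws `W 0` and
`W 1`: the mutual information between a uniform input bit and the corresponding output, that is
`∑ x, (1/2) * D(W x ‖ (W 0 + W 1)/2)` with `D` the Kullback-Leibler divergence to base `2`. -/
noncomputable def symCapacity (W : ZMod 2 → Measure Y) : ℝ≥0∞ :=
  (∑ x : ZMod 2, 2⁻¹ * InformationTheory.klDiv (W x) ((2⁻¹ : ℝ≥0∞) • (W 0 + W 1))) /
    ENNReal.ofReal (Real.log 2)

/-- The law of one received symbol when the code bit `x` is sent over `W`, the position being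
punctured iff `p = true`. The output alphabet is extended by one symbol, `Sum.inr ()`, which is
received exactly at the punctured positions. -/
noncomputable def puncturedLaw (W : ZMod 2 → Measure Y) (p : Bool) (x : ZMod 2) :
    Measure (Y ⊕ Unit) :=
  if p then Measure.dirac (Sum.inr ()) else (W x).map Sum.inl

/-- The law of the punctured received sequence when the data vector `u` is encoded as `u · G_N`
and sent over the memoryless channel `W`. -/
noncomputable def receivedLaw (W : ZMod 2 → Measure Y) {n : ℕ} (P : Pattern n)
    (u : Fin (2 ^ n) → ZMod 2) : Measure (Fin (2 ^ n) → Y ⊕ Unit) :=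
  Measure.pi fun j => puncturedLaw W (P j) ((u ᵥ* genMatrix n) j)

/-- The `i`-th virtual channel: its input is the data bit `u i`, its output is the punctured
received sequence together with the preceding data bits, and the data bits other than `u i` are
independent and uniform. -/
noncomputable def virtualChannel (W : ZMod 2 → Measure Y) {n : ℕ} (P : Pattern n)
    (i : Fin (2 ^ n)) (b : ZMod 2) :
    Measure ((Fin (2 ^ n) → Y ⊕ Unit) × ({j : Fin (2 ^ n) // j < i} → ZMod 2)) :=
  ((2 : ℝ≥0∞) ^ (2 ^ n - 1))⁻¹ •
    ∑ u : Fin (2 ^ n) → ZMod 2 with u i = b,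
      (receivedLaw W P u).prod (Measure.dirac fun j : {j // j < i} => u j)

open Classical in
/-- The data bit erasure pattern `E[P]` (for the channel `W`): it marks the positions whose virtual
channel has symmetric capacity zero. -/
noncomputable def erasurePattern (W : ZMod 2 → Measure Y) {n : ℕ} (P : Pattern n) : Pattern n :=
  fun i => decide (symCapacity (virtualChannel W P i) = 0)

/-- `P` is symmetric if `E[P] = P`. -/
def IsSymmetric (W : ZMod 2 → Measure Y) {n : ℕ} (P : Pattern n) : Prop :=
  erasurePattern W P = P

end Channel

/-! ### Equivalent and primitive patterns -/

/-- The bit-reversal permutation `B_N` of `{0, …, N - 1}`, `N = 2 ^ n`: the number with binary digits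
`d 0, …, d (n - 1)` (least significant first) is sent to the number with digits
`d (n - 1), …, d 0`. -/
def bitReversal (n : ℕ) : Equiv.Perm (Fin (2 ^ n)) :=
  finFunctionFinEquiv.symm.trans
    ((Equiv.arrowCongr Fin.revPerm (Equiv.refl (Fin 2))).trans finFunctionFinEquiv)

/-- The action of a permutation `f` of the positions: `f(A)(i) = A(f(i))`. -/
def permute {n : ℕ} (f : Fin (2 ^ n) → Fin (2 ^ n)) (A : Pattern n) : Pattern n :=
  fun i => A (f i)

/-- The starting positions `k = m * 2 ^ (j + 1)` run over `0, 2 ^ (j + 1), …, N - 2 ^ (j + 1)`. -/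
theorem block_le {n : ℕ} (j : Fin n) (m : Fin (2 ^ (n - 1 - j))) :
    m.1 * 2 ^ (j.1 + 1) + 2 ^ (j.1 + 1) ≤ 2 ^ n := by
  have hj := j.2
  have h : 2 ^ n = 2 ^ (n - 1 - j.1) * 2 ^ (j.1 + 1) := by
    rw [← pow_add]
    congr 1
    omega
  calc m.1 * 2 ^ (j.1 + 1) + 2 ^ (j.1 + 1) = (m.1 + 1) * 2 ^ (j.1 + 1) := by ring
    _ ≤ 2 ^ (n - 1 - j.1) * 2 ^ (j.1 + 1) := Nat.mul_le_mul_right _ m.2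
    _ = 2 ^ n := h.symm

/-- The elementary permutation `φ_{k,j}`, with `k = m * 2 ^ (j + 1)`: it swaps the blocks
`[k, k + 2 ^ j - 1]` and `[k + 2 ^ j, k + 2 ^ (j + 1) - 1]`. -/
def elemPerm {n : ℕ} (j : Fin n) (m : Fin (2 ^ (n - 1 - j))) (i : Fin (2 ^ n)) : Fin (2 ^ n) :=
  if i.1 < m.1 * 2 ^ (j.1 + 1) ∨ m.1 * 2 ^ (j.1 + 1) + 2 ^ (j.1 + 1) ≤ i.1 then i
  else if h : i.1 < m.1 * 2 ^ (j.1 + 1) + 2 ^ j.1 then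
    ⟨i.1 + 2 ^ j.1, by
      have := block_le j m
      have h2 : 2 ^ (j.1 + 1) = 2 ^ j.1 + 2 ^ j.1 := by ring
      omega⟩
  else ⟨i.1 - 2 ^ j.1, lt_of_le_of_lt (Nat.sub_le _ _) i.2⟩

/-- The patterns `P` and `P'` are equivalent if
`P' = B_N(φ_{k_t,j_t}(⋯ φ_{k_1,j_1}(B_N(P)) ⋯))` for a finite sequence of elementary
permutations. -/
def Equivalent {n : ℕ} (P P' : Pattern n) : Prop :=
  ∃ L : List (Σ j : Fin n, Fin (2 ^ (n - 1 - j))),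
    P' = permute (bitReversal n)
      (L.foldl (fun A s => permute (elemPerm s.1 s.2) A) (permute (bitReversal n) P))

/-- The strict lexicographic order `a <_lex b` of binary vectors. -/
def LexLT {l : ℕ} (a b : Fin l → Bool) : Prop :=
  ∃ i, (∀ j < i, a j = b j) ∧ a i < b i

instance instDecidableLexLT {l : ℕ} (a b : Fin l → Bool) : Decidable (LexLT a b) := by
  unfold LexLT
  infer_instance

/-- The block `[P(k), …, P(k + 2 ^ j - 1)]`, `k = m * 2 ^ (j + 1)`. -/
def leftBlock {n : ℕ} (j : Fin n) (m : Fin (2 ^ (n - 1 - j))) (P : Pattern n) :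
    Fin (2 ^ j.1) → Bool :=
  fun r => P ⟨m.1 * 2 ^ (j.1 + 1) + r.1, by
    have := block_le j m
    have h2 : 2 ^ (j.1 + 1) = 2 ^ j.1 + 2 ^ j.1 := by ring
    have := r.2
    omega⟩

/-- The block `[P(k + 2 ^ j), …, P(k + 2 ^ (j + 1) - 1)]`, `k = m * 2 ^ (j + 1)`. -/
def rightBlock {n : ℕ} (j : Fin n) (m : Fin (2 ^ (n - 1 - j))) (P : Pattern n) :
    Fin (2 ^ j.1) → Bool :=
  fun r => P ⟨m.1 * 2 ^ (j.1 + 1) + 2 ^ j.1 + r.1, by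
    have := block_le j m
    have h2 : 2 ^ (j.1 + 1) = 2 ^ j.1 + 2 ^ j.1 := by ring
    have := r.2
    omega⟩

/-- One step of the algorithm: the two blocks are swapped iff the left one is lexicographically
smaller than the right one. -/
def sortStep {n : ℕ} (j : Fin n) (m : Fin (2 ^ (n - 1 - j))) (P : Pattern n) : Pattern n :=
  if LexLT (leftBlock j m P) (rightBlock j m P) then permute (elemPerm j m) P else P

/-- The algorithm `φ`: for `j = 0, …, n - 1` and then for `k = 0, 2 ^ (j + 1), …, N - 2 ^ (j + 1)`,
in this order, perform the step for `(k, j)`. -/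
def sortPattern {n : ℕ} (P : Pattern n) : Pattern n :=
  (List.finRange n).foldl
    (fun Q j => (List.finRange (2 ^ (n - 1 - j.1))).foldl (fun R m => sortStep j m R) Q) P

/-- `Φ(P) = B_N(φ(B_N(P)))`. -/
def Phi {n : ℕ} (P : Pattern n) : Pattern n :=
  permute (bitReversal n) (sortPattern (permute (bitReversal n) P))

/-- `P` is primitive if `Φ(P) = P`. -/
def IsPrimitive {n : ℕ} (P : Pattern n) : Prop :=
  Phi P = P

end PolarCode

/-!
Deleting the least significant digit of a position splits every pattern `P` into its even part `P₀`
and its odd part `P₁`. The even and odd parts of `E[P]` are `E[P₀] ∨ E[P₁]` and `E[P₀] ∧ E[P₁]`: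
for an even data bit, the difference between the likelihoods of its two values is the product of
the corresponding differences for `P₀` and `P₁`; for an odd data bit, ignoring the symbols received
in one of the parts isolates the other part. Hence erasure patterns preserve the number of ones,
and if `E[P] = P`, then `E[P₀] ≤ P₀` and `P₁ ≤ E[P₁]` are equalities and `P₁ ≤ P₀`. So `P₀` and
`P₁` are again symmetric.

The sorting algorithm, applied to a concatenation, sorts both halves and then puts the two results
in nonincreasing lexicographic order. Bit reversal turns `P₀` and `P₁` into the two halves; by
induction these are already sorted, and `P₁ ≤ P₀` says that they are in order, so `P` is primitive.
The same recursion shows that the result of the algorithm is unchanged by elementary permutations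
of its input, so `Φ` is constant on equivalence classes.
-/

namespace PolarCode

/-! ### Splitting off a binary digit of a position -/

section Digits

variable {α : Type*} {n : ℕ}

/-- The position `2 * i + a`, whose digits are those of `i` preceded by the least significant
digit `a`, as in `Fin.cons`. -/
def consBit : Fin 2 × Fin (2 ^ n) ≃ Fin (2 ^ (n + 1)) :=
  (Equiv.prodComm _ _).trans (finProdFinEquiv.trans (finCongr (pow_succ 2 n).symm))

/-- The position `i + 2 ^ n * a`, whose digits are those of `i` followed by the most significant
digit `a`, as in `Fin.snoc`. -/
def snocBit : Fin (2 ^ n) × Fin 2 ≃ Fin (2 ^ (n + 1)) :=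
  (Equiv.prodComm _ _).trans (finProdFinEquiv.trans (finCongr (pow_succ' 2 n).symm))

theorem val_consBit (a : Fin 2) (i : Fin (2 ^ n)) : (consBit (a, i)).1 = a + 2 * i := rfl

theorem val_snocBit (i : Fin (2 ^ n)) (a : Fin 2) : (snocBit (i, a)).1 = i + 2 ^ n * a := rfl

theorem consBit_snocBit (a b : Fin 2) (i : Fin (2 ^ n)) :
    consBit (a, snocBit (i, b)) = snocBit (consBit (a, i), b) := by
  ext
  simp only [val_consBit, val_snocBit]
  ring

theorem finFunctionFinEquiv_cons (a : Fin 2) (d : Fin n → Fin 2) :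
    finFunctionFinEquiv (Fin.cons a d : Fin (n + 1) → Fin 2) =
      consBit (a, finFunctionFinEquiv d) := by
  ext
  simp only [finFunctionFinEquiv_apply, val_consBit, Fin.sum_univ_succ, Fin.cons_zero,
    Fin.cons_succ, Fin.val_zero, pow_zero, mul_one, Fin.val_succ, Finset.mul_sum, pow_succ]
  exact congrArg _ (Finset.sum_congr rfl fun _ _ => by ring)

theorem finFunctionFinEquiv_snoc (d : Fin n → Fin 2) (a : Fin 2) :
    finFunctionFinEquiv (Fin.snoc d a : Fin (n + 1) → Fin 2) =
      snocBit (finFunctionFinEquiv d, a) := by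
  ext
  simp [val_snocBit, Fin.sum_univ_castSucc, mul_comm]

theorem consBit_lt_consBit_zero (a : Fin 2) (k i : Fin (2 ^ n)) :
    consBit (a, k) < consBit (0, i) ↔ k < i := by
  simp only [Fin.lt_def, val_consBit, Fin.val_zero]
  omega

theorem consBit_lt_consBit_one (a : Fin 2) (k i : Fin (2 ^ n)) :
    consBit (a, k) < consBit (1, i) ↔ k < i ∨ a = 0 ∧ k = i := by
  simp only [Fin.lt_def, Fin.ext_iff, val_consBit, Fin.val_zero, Fin.val_one]
  omega

/-- The entries of a vector at the positions `2 * i + a`. -/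
def parityPart (a : Fin 2) (u : Fin (2 ^ (n + 1)) → α) (i : Fin (2 ^ n)) : α :=
  u (consBit (a, i))

/-- The vector with given entries at the even and at the odd positions. -/
def interleave (u : Fin 2 → Fin (2 ^ n) → α) (k : Fin (2 ^ (n + 1))) : α :=
  u (consBit.symm k).1 (consBit.symm k).2

/-- The concatenation of two vectors. -/
def concat (u : Fin 2 → Fin (2 ^ n) → α) (k : Fin (2 ^ (n + 1))) : α :=
  u (snocBit.symm k).2 (snocBit.symm k).1

@[simp] theorem interleave_consBit (u : Fin 2 → Fin (2 ^ n) → α) (a : Fin 2) (i : Fin (2 ^ n)) :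
    interleave u (consBit (a, i)) = u a i := by
  simp [interleave]

@[simp] theorem parityPart_interleave (a : Fin 2) (u : Fin 2 → Fin (2 ^ n) → α) :
    parityPart a (interleave u) = u a :=
  funext fun i => interleave_consBit u a i

@[simp] theorem concat_snocBit (u : Fin 2 → Fin (2 ^ n) → α) (i : Fin (2 ^ n)) (a : Fin 2) :
    concat u (snocBit (i, a)) = u a i := by
  simp [concat]

theorem eq_concat_iff {v : Fin (2 ^ (n + 1)) → α} {u : Fin 2 → Fin (2 ^ n) → α} :
    v = concat u ↔ ∀ i a, v (snocBit (i, a)) = u a i := by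
  rw [funext_iff, ← snocBit.forall_congr_right, Prod.forall]
  simp only [concat_snocBit]

theorem forall_consBit {p : Fin (2 ^ (n + 1)) → Prop} :
    (∀ k, p k) ↔ (∀ i, p (consBit (0, i))) ∧ ∀ i, p (consBit (1, i)) := by
  rw [← consBit.forall_congr_right, Prod.forall, Fin.forall_fin_two]

theorem prod_consBit {M : Type*} [CommMonoid M] (f : Fin (2 ^ (n + 1)) → M) :
    ∏ k, f k = (∏ i, f (consBit (0, i))) * ∏ i, f (consBit (1, i)) := by
  rw [← consBit.prod_comp, Fintype.prod_prod_type, Fin.prod_univ_two]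

theorem interleave_mem {F : Fin (2 ^ (n + 1)) → Set α} {f g : Fin (2 ^ n) → α}
    (hf : ∀ i, f i ∈ parityPart 0 F i) (hg : ∀ i, g i ∈ parityPart 1 F i)
    (k : Fin (2 ^ (n + 1))) : interleave ![f, g] k ∈ F k := by
  revert k
  refine forall_consBit.2 ⟨fun i => ?_, fun i => ?_⟩
  · rw [interleave_consBit]
    exact hf i
  · rw [interleave_consBit]
    exact hg i

theorem sum_consBit {M : Type*} [AddCommMonoid M] (f : Fin (2 ^ (n + 1)) → M) :
    ∑ k, f k = ∑ i, f (consBit (0, i)) + ∑ i, f (consBit (1, i)) := by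
  rw [← consBit.sum_comp, Fintype.sum_prod_type, Fin.sum_univ_two]

end Digits

/-! ### Bit reversal -/

section BitReversal

variable {n : ℕ}

theorem bitReversal_finFunctionFinEquiv (d : Fin n → Fin 2) :
    bitReversal n (finFunctionFinEquiv d) = finFunctionFinEquiv (d ∘ Fin.rev) := by
  simp only [bitReversal, Equiv.trans_apply, Equiv.symm_apply_apply]
  rfl

theorem bitReversal_involutive (n : ℕ) : Function.Involutive (bitReversal n) := by
  intro i
  obtain ⟨d, rfl⟩ := finFunctionFinEquiv.surjective i
  simp only [bitReversal_finFunctionFinEquiv, Function.comp_assoc, Fin.rev_involutive.comp_self,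
    Function.comp_id]

theorem bitReversal_snocBit (i : Fin (2 ^ n)) (a : Fin 2) :
    bitReversal (n + 1) (snocBit (i, a)) = consBit (a, bitReversal n i) := by
  obtain ⟨d, rfl⟩ := finFunctionFinEquiv.surjective i
  rw [← finFunctionFinEquiv_snoc, bitReversal_finFunctionFinEquiv,
    bitReversal_finFunctionFinEquiv, ← finFunctionFinEquiv_cons, Fin.snoc_comp_rev]

theorem permute_bitReversal_involutive (n : ℕ) :
    Function.Involutive (permute (bitReversal n)) := fun P =>
  funext fun i => congrArg P (bitReversal_involutive n i)

theorem permute_bitReversal_succ (P : Pattern (n + 1)) :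
    permute (bitReversal (n + 1)) P =
      concat fun a => permute (bitReversal n) (parityPart a P) :=
  eq_concat_iff.2 fun i a => congrArg P (bitReversal_snocBit i a)

end BitReversal

/-! ### The sorting algorithm on a concatenation -/

section Sorting

variable {n : ℕ}

theorem two_pow_castSucc (j : Fin n) :
    2 ^ (n + 1 - 1 - j.castSucc.1) = 2 * 2 ^ (n - 1 - j.1) := by
  rw [← pow_succ', Fin.val_castSucc]
  congr 1
  omega

/-- The number, within `n + 1` levels, of the `m`-th block in the half `a`. -/
def halfBlock (j : Fin n) (a : Fin 2) (m : Fin (2 ^ (n - 1 - j))) :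
    Fin (2 ^ (n + 1 - 1 - j.castSucc)) :=
  finCongr (two_pow_castSucc j).symm (finProdFinEquiv (a, m))

theorem exists_halfBlock_eq (j : Fin n) (m : Fin (2 ^ (n + 1 - 1 - j.castSucc))) :
    ∃ a m', halfBlock j a m' = m := by
  obtain ⟨⟨a, m'⟩, rfl⟩ :=
    (finProdFinEquiv.trans (finCongr (two_pow_castSucc j).symm)).surjective m
  exact ⟨a, m', rfl⟩

theorem val_halfBlock_mul (j : Fin n) (a : Fin 2) (m : Fin (2 ^ (n - 1 - j))) :
    (halfBlock j a m).1 * 2 ^ (j.1 + 1) = m * 2 ^ (j.1 + 1) + 2 ^ n * a := by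
  have hn : 2 ^ (n - 1 - j.1) * 2 ^ (j.1 + 1) = 2 ^ n := by
    rw [← pow_add]
    congr 1
    omega
  change (m.1 + 2 ^ (n - 1 - j.1) * a.1) * 2 ^ (j.1 + 1) = _
  rw [← hn]
  ring

theorem val_last_block (m : Fin (2 ^ (n + 1 - 1 - Fin.last n))) : m.1 = 0 := by
  have := m.2
  simpa using this

theorem val_elemPerm (j : Fin n) (m : Fin (2 ^ (n - 1 - j))) (i : Fin (2 ^ n)) :
    (elemPerm j m i).1 =
      if i.1 < m * 2 ^ (j.1 + 1) ∨ m * 2 ^ (j.1 + 1) + 2 ^ (j.1 + 1) ≤ i.1 then i.1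
      else if i.1 < m * 2 ^ (j.1 + 1) + 2 ^ j.1 then i + 2 ^ j.1 else i - 2 ^ j.1 := by
  unfold elemPerm
  split_ifs <;> rfl

theorem elemPerm_halfBlock_snocBit_self (j : Fin n) (a : Fin 2) (m : Fin (2 ^ (n - 1 - j)))
    (i : Fin (2 ^ n)) :
    elemPerm j.castSucc (halfBlock j a m) (snocBit (i, a)) = snocBit (elemPerm j m i, a) := by
  ext
  simp only [val_elemPerm, val_snocBit, val_halfBlock_mul, Fin.val_castSucc]
  split_ifs <;> omega

theorem elemPerm_halfBlock_snocBit_of_ne (j : Fin n) {a b : Fin 2} (hab : b ≠ a)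
    (m : Fin (2 ^ (n - 1 - j))) (i : Fin (2 ^ n)) :
    elemPerm j.castSucc (halfBlock j a m) (snocBit (i, b)) = snocBit (i, b) := by
  have hm := block_le j m
  have hi := i.2
  ext
  simp only [val_elemPerm, val_snocBit, val_halfBlock_mul, Fin.val_castSucc]
  refine if_pos ?_
  rcases lt_or_gt_of_ne hab with hlt | hlt
  · have hhalf := Nat.mul_le_mul_left (2 ^ n) (Nat.succ_le_of_lt hlt)
    rw [Nat.mul_succ] at hhalf
    omega
  · have hhalf := Nat.mul_le_mul_left (2 ^ n) (Nat.succ_le_of_lt hlt)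
    rw [Nat.mul_succ] at hhalf
    omega

theorem elemPerm_last_snocBit (m : Fin (2 ^ (n + 1 - 1 - Fin.last n))) (i : Fin (2 ^ n))
    (a : Fin 2) : elemPerm (Fin.last n) m (snocBit (i, a)) = snocBit (i, a.rev) := by
  have hi := i.2
  ext
  simp only [val_elemPerm, val_snocBit, val_last_block, Fin.val_last, Fin.val_rev, pow_succ]
  have ha : a.1 = 0 ∨ a.1 = 1 := by omega
  rcases ha with ha | ha <;> rw [ha] <;> split_ifs <;> omega

theorem permute_elemPerm_halfBlock_concat (j : Fin n) (a : Fin 2) (m : Fin (2 ^ (n - 1 - j)))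
    (A : Fin 2 → Pattern n) :
    permute (elemPerm j.castSucc (halfBlock j a m)) (concat A) =
      concat (Function.update A a (permute (elemPerm j m) (A a))) := by
  refine eq_concat_iff.2 fun i b => ?_
  rcases eq_or_ne b a with rfl | hb
  · simp [permute, elemPerm_halfBlock_snocBit_self]
  · simp [permute, elemPerm_halfBlock_snocBit_of_ne j hb, hb]

theorem permute_elemPerm_last_concat (m : Fin (2 ^ (n + 1 - 1 - Fin.last n)))
    (A : Fin 2 → Pattern n) :
    permute (elemPerm (Fin.last n) m) (concat A) = concat (A ∘ Fin.rev) :=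
  eq_concat_iff.2 fun i a => by simp [permute, elemPerm_last_snocBit]

theorem leftBlock_halfBlock_concat (j : Fin n) (a : Fin 2) (m : Fin (2 ^ (n - 1 - j)))
    (A : Fin 2 → Pattern n) :
    leftBlock j.castSucc (halfBlock j a m) (concat A) = leftBlock j m (A a) := by
  funext r
  rw [leftBlock, leftBlock, ← concat_snocBit A]
  congr 1
  ext
  simp only [val_snocBit, val_halfBlock_mul, Fin.val_castSucc]
  ring

theorem rightBlock_halfBlock_concat (j : Fin n) (a : Fin 2) (m : Fin (2 ^ (n - 1 - j)))
    (A : Fin 2 → Pattern n) :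
    rightBlock j.castSucc (halfBlock j a m) (concat A) = rightBlock j m (A a) := by
  funext r
  rw [rightBlock, rightBlock, ← concat_snocBit A]
  congr 1
  ext
  simp only [val_snocBit, val_halfBlock_mul, Fin.val_castSucc]
  ring

theorem leftBlock_last_concat (m : Fin (2 ^ (n + 1 - 1 - Fin.last n))) (A : Fin 2 → Pattern n) :
    leftBlock (Fin.last n) m (concat A) = A 0 := by
  funext r
  rw [leftBlock, ← concat_snocBit A]
  congr 1
  ext
  simp [val_snocBit, val_last_block]

theorem rightBlock_last_concat (m : Fin (2 ^ (n + 1 - 1 - Fin.last n))) (A : Fin 2 → Pattern n) :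
    rightBlock (Fin.last n) m (concat A) = A 1 := by
  funext r
  rw [rightBlock, ← concat_snocBit A]
  congr 1
  ext
  simp [val_snocBit, val_last_block, add_comm]

theorem sortStep_halfBlock_concat (j : Fin n) (a : Fin 2) (m : Fin (2 ^ (n - 1 - j)))
    (A : Fin 2 → Pattern n) :
    sortStep j.castSucc (halfBlock j a m) (concat A) =
      concat (Function.update A a (sortStep j m (A a))) := by
  simp only [sortStep, leftBlock_halfBlock_concat, rightBlock_halfBlock_concat,
    permute_elemPerm_halfBlock_concat]
  split_ifs
  · rfl
  · rw [Function.update_eq_self]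

/-- The concatenation of two patterns in lexicographically nonincreasing order. -/
def sortedConcat (A : Fin 2 → Pattern n) : Pattern (n + 1) :=
  if LexLT (A 0) (A 1) then concat (A ∘ Fin.rev) else concat A

theorem lexLT_trichotomy {l : ℕ} (a b : Fin l → Bool) : LexLT a b ∨ a = b ∨ LexLT b a :=
  lt_trichotomy (toLex a) (toLex b)

theorem LexLT.not_lexLT {l : ℕ} {a b : Fin l → Bool} (h : LexLT a b) : ¬ LexLT b a :=
  lt_asymm (a := toLex a) (b := toLex b) h

theorem sortedConcat_comp_rev (A : Fin 2 → Pattern n) :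
    sortedConcat (A ∘ Fin.rev) = sortedConcat A := by
  have hrev : (A ∘ Fin.rev) ∘ Fin.rev = A := by
    rw [Function.comp_assoc, Fin.rev_involutive.comp_self, Function.comp_id]
  have hzero : (A ∘ Fin.rev) 0 = A 1 := rfl
  have hone : (A ∘ Fin.rev) 1 = A 0 := rfl
  rw [sortedConcat, sortedConcat, hrev, hzero, hone]
  rcases lexLT_trichotomy (A 0) (A 1) with h | h | h
  · rw [if_neg h.not_lexLT, if_pos h]
  · have hA : A ∘ Fin.rev = A := by
      funext a
      fin_cases a
      exacts [h.symm, h]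
    simp only [hA, ite_self]
  · rw [if_pos h, if_neg h.not_lexLT]

theorem sortStep_last_concat (m : Fin (2 ^ (n + 1 - 1 - Fin.last n))) (A : Fin 2 → Pattern n) :
    sortStep (Fin.last n) m (concat A) = sortedConcat A := by
  simp only [sortStep, leftBlock_last_concat, rightBlock_last_concat,
    permute_elemPerm_last_concat, sortedConcat]

/-- The steps of the algorithm for one block length `2 ^ j`. -/
def sortLevel (j : Fin n) (P : Pattern n) : Pattern n :=
  (List.finRange (2 ^ (n - 1 - j))).foldl (fun Q m => sortStep j m Q) P

theorem sortPattern_eq_foldl_sortLevel (P : Pattern n) :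
    sortPattern P = (List.finRange n).foldl (fun Q j => sortLevel j Q) P := rfl

theorem foldl_sortStep_halfBlock_concat (j : Fin n) (a : Fin 2)
    (l : List (Fin (2 ^ (n - 1 - j)))) (A : Fin 2 → Pattern n) :
    l.foldl (fun Q m => sortStep j.castSucc (halfBlock j a m) Q) (concat A) =
      concat (Function.update A a (l.foldl (fun Q m => sortStep j m Q) (A a))) := by
  induction l generalizing A with
  | nil => simp
  | cons m l ih => simp [sortStep_halfBlock_concat, ih]

theorem finRange_eq_append_of_eq_two_mul {N k : ℕ} (h : N = 2 * k) :
    List.finRange N =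
      (List.finRange k).map (fun m => finCongr h.symm (finProdFinEquiv (0, m))) ++
        (List.finRange k).map fun m => finCongr h.symm (finProdFinEquiv (1, m)) := by
  subst h
  simp only [← List.ofFn_id, List.map_ofFn, List.ofFn_mul, List.ofFn_succ, List.ofFn_zero,
    List.flatten_cons, List.flatten_nil, List.append_nil]
  congr 2 <;> funext m <;> ext <;> simp [add_comm]

theorem finRange_eq_map_halfBlock (j : Fin n) :
    List.finRange (2 ^ (n + 1 - 1 - j.castSucc)) =
      (List.finRange (2 ^ (n - 1 - j))).map (halfBlock j 0) ++
        (List.finRange (2 ^ (n - 1 - j))).map (halfBlock j 1) :=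
  finRange_eq_append_of_eq_two_mul (two_pow_castSucc j)

theorem sortLevel_castSucc_concat (j : Fin n) (A : Fin 2 → Pattern n) :
    sortLevel j.castSucc (concat A) = concat fun a => sortLevel j (A a) := by
  rw [sortLevel, finRange_eq_map_halfBlock, List.foldl_append, List.foldl_map, List.foldl_map,
    foldl_sortStep_halfBlock_concat, foldl_sortStep_halfBlock_concat]
  congr 1
  funext a
  fin_cases a <;> rfl

theorem sortLevel_last_concat (A : Fin 2 → Pattern n) :
    sortLevel (Fin.last n) (concat A) = sortedConcat A := by
  obtain ⟨m, hm⟩ : ∃ m, List.finRange (2 ^ (n + 1 - 1 - Fin.last n)) = [m] :=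
    List.length_eq_one_iff.1 (by simp)
  rw [sortLevel, hm, List.foldl_cons, List.foldl_nil, sortStep_last_concat]

theorem foldl_sortLevel_castSucc_concat (l : List (Fin n)) (A : Fin 2 → Pattern n) :
    l.foldl (fun Q j => sortLevel j.castSucc Q) (concat A) =
      concat fun a => l.foldl (fun Q j => sortLevel j Q) (A a) := by
  induction l generalizing A with
  | nil => rfl
  | cons j l ih => simp only [List.foldl_cons, sortLevel_castSucc_concat, ih]

theorem sortPattern_concat (A : Fin 2 → Pattern n) :
    sortPattern (concat A) = sortedConcat fun a => sortPattern (A a) := by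
  simp only [sortPattern_eq_foldl_sortLevel]
  rw [List.finRange_succ_last, List.foldl_append, List.foldl_map, foldl_sortLevel_castSucc_concat,
    List.foldl_cons, List.foldl_nil, sortLevel_last_concat]

theorem sortPattern_permute_elemPerm (j : Fin n) (m : Fin (2 ^ (n - 1 - j))) (P : Pattern n) :
    sortPattern (permute (elemPerm j m) P) = sortPattern P := by
  induction n with
  | zero => exact j.elim0
  | succ n ih =>
    obtain ⟨A, rfl⟩ : ∃ A : Fin 2 → Pattern n, P = concat A :=
      ⟨_, eq_concat_iff.2 fun _ _ => rfl⟩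
    induction j using Fin.lastCases with
    | last =>
      rw [permute_elemPerm_last_concat, sortPattern_concat, sortPattern_concat]
      exact sortedConcat_comp_rev fun a => sortPattern (A a)
    | cast j =>
      obtain ⟨a, m, rfl⟩ := exists_halfBlock_eq j m
      rw [permute_elemPerm_halfBlock_concat, sortPattern_concat, sortPattern_concat]
      congr 1
      funext b
      rcases eq_or_ne b a with rfl | hb
      · simp [ih]
      · simp [hb]

end Sorting

/-! ### Equivalent and primitive patterns -/

section Primitive

variable {n : ℕ} {P P' : Pattern n}

theorem Equivalent.phi_eq (h : Equivalent P P') : Phi P' = Phi P := by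
  obtain ⟨L, rfl⟩ := h
  rw [Phi, Phi, permute_bitReversal_involutive]
  congr 1
  generalize permute (bitReversal n) P = A
  induction L generalizing A with
  | nil => rfl
  | cons s L ih => rw [List.foldl_cons, ih, sortPattern_permute_elemPerm]

theorem IsPrimitive.eq_of_equivalent (hP : IsPrimitive P) (hP' : IsPrimitive P')
    (h : Equivalent P P') : P' = P :=
  calc P' = Phi P' := hP'.symm
    _ = Phi P := h.phi_eq
    _ = P := hP

theorem isPrimitive_iff_sortPattern_eq :
    IsPrimitive P ↔ sortPattern (permute (bitReversal n) P) = permute (bitReversal n) P :=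
  (permute_bitReversal_involutive n).eq_iff

theorem not_lexLT_of_le {l : ℕ} {a b : Fin l → Bool} (h : b ≤ a) : ¬ LexLT a b :=
  fun ⟨i, _, hi⟩ => (h i).not_gt hi

theorem isPrimitive_of_parityPart {P : Pattern (n + 1)}
    (hprim : ∀ a, IsPrimitive (parityPart a P)) (hle : parityPart 1 P ≤ parityPart 0 P) :
    IsPrimitive P := by
  simp only [isPrimitive_iff_sortPattern_eq] at hprim ⊢
  simp only [permute_bitReversal_succ, sortPattern_concat, hprim, sortedConcat]
  exact if_neg (not_lexLT_of_le fun i => hle _)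

end Primitive

/-! ### The butterfly structure of the encoder -/

section Encoder

variable {n : ℕ}

theorem genMatrix_snocBit (i j : Fin (2 ^ n)) (a b : Fin 2) :
    genMatrix (n + 1) (snocBit (i, a)) (snocBit (j, b)) = kernelMatrix a b * genMatrix n i j := by
  have hsymm (i : Fin (2 ^ n)) (a : Fin 2) :
      (finProdFinEquiv.trans (finCongr (pow_succ' 2 n).symm)).symm (snocBit (i, a)) = (a, i) := by
    rw [Equiv.symm_apply_eq]
    rfl
  rw [genMatrix, Matrix.reindex_apply, Matrix.submatrix_apply, hsymm, hsymm,
    Matrix.kroneckerMap_apply]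

theorem genMatrix_consBit (i j : Fin (2 ^ n)) (a b : Fin 2) :
    genMatrix (n + 1) (consBit (a, i)) (consBit (b, j)) = kernelMatrix a b * genMatrix n i j := by
  induction n with
  | zero =>
    have hcons (i : Fin (2 ^ 0)) (a : Fin 2) : consBit (a, i) = snocBit (i, a) := by
      rw [Fin.ext_iff, val_consBit, val_snocBit, Fin.val_eq_zero (show Fin 1 from i)]
      simp
    rw [hcons, hcons, genMatrix_snocBit]
  | succ n ih =>
    obtain ⟨⟨i, c⟩, rfl⟩ := snocBit.surjective i
    obtain ⟨⟨j, d⟩, rfl⟩ := snocBit.surjective j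
    rw [consBit_snocBit, consBit_snocBit, genMatrix_snocBit, genMatrix_snocBit, ih]
    ring

theorem parityPart_zero_vecMul_genMatrix (u : Fin (2 ^ (n + 1)) → ZMod 2) :
    parityPart 0 (u ᵥ* genMatrix (n + 1)) = (parityPart 0 u + parityPart 1 u) ᵥ* genMatrix n := by
  funext j
  rw [Matrix.add_vecMul]
  simp [parityPart, Matrix.vecMul, dotProduct, sum_consBit, genMatrix_consBit, kernelMatrix]

theorem parityPart_one_vecMul_genMatrix (u : Fin (2 ^ (n + 1)) → ZMod 2) :
    parityPart 1 (u ᵥ* genMatrix (n + 1)) = parityPart 1 u ᵥ* genMatrix n := by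
  funext j
  simp [parityPart, Matrix.vecMul, dotProduct, sum_consBit, genMatrix_consBit, kernelMatrix]

/-- The change of data vectors under which encoding with `G_{2N}` becomes encoding of two
independent vectors with `G_N`. -/
def butterfly {α : Type*} [AddGroup α] :
    (Fin (2 ^ (n + 1)) → α) ≃ (Fin (2 ^ n) → α) × (Fin (2 ^ n) → α) where
  toFun u := (parityPart 0 u + parityPart 1 u, parityPart 1 u)
  invFun v := interleave ![v.1 - v.2, v.2]
  left_inv u := by
    funext k
    obtain ⟨⟨a, i⟩, rfl⟩ := consBit.surjective k
    fin_cases a <;> simp [parityPart]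
  right_inv v := by simp

theorem butterfly_apply {α : Type*} [AddGroup α] (u : Fin (2 ^ (n + 1)) → α) :
    butterfly u = (parityPart 0 u + parityPart 1 u, parityPart 1 u) := rfl

end Encoder

/-! ### Likelihoods of a data bit -/

section Likelihood

variable {n : ℕ} {R : Type*}

/-- The likelihood of the value `b` of the data bit `u i` given the previous data bits `c` (of which
only those before `i` matter), when `f j x` is the likelihood of the code bit `x` at position `j`.
It is `2 ^ (N - 1) * W_N^{(i)}(y, c | b)` in the usual notation for polar codes. -/
def bitLikelihood [CommSemiring R] (f : Fin (2 ^ n) → ZMod 2 → R) (i : Fin (2 ^ n))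
    (c : Fin (2 ^ n) → ZMod 2) (b : ZMod 2) : R :=
  ∑ u : Fin (2 ^ n) → ZMod 2 with u i = b ∧ ∀ k < i, u k = c k, ∏ j, f j ((u ᵥ* genMatrix n) j)

theorem sum_zmod_two {M : Type*} [AddCommMonoid M] (f : ZMod 2 → M) : ∑ x, f x = f 0 + f 1 :=
  Fin.sum_univ_two f

section CommSemiring

variable [CommSemiring R]

theorem bitLikelihood_congr (f : Fin (2 ^ n) → ZMod 2 → R) {i : Fin (2 ^ n)}
    {c d : Fin (2 ^ n) → ZMod 2} (h : ∀ k < i, c k = d k) :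
    bitLikelihood f i c = bitLikelihood f i d := by
  funext b
  refine Finset.sum_congr (Finset.filter_congr fun u _ => ?_) fun _ _ => rfl
  exact and_congr_right fun _ => forall₂_congr fun k hk => by rw [h k hk]

theorem bitLikelihood_zero (f : Fin (2 ^ 0) → ZMod 2 → R) (i : Fin (2 ^ 0))
    (c : Fin (2 ^ 0) → ZMod 2) (b : ZMod 2) : bitLikelihood f i c b = f i b := by
  have hi (k : Fin (2 ^ 0)) : k = i := Subsingleton.elim (α := Fin 1) k i
  have hset : Finset.univ.filter (fun u : Fin (2 ^ 0) → ZMod 2 => u i = b ∧ ∀ k < i, u k = c k) =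
      {fun _ => b} := by
    ext u
    simp only [Finset.mem_filter, Finset.mem_univ, true_and, Finset.mem_singleton]
    refine ⟨fun h => funext fun k => hi k ▸ h.1, ?_⟩
    rintro rfl
    exact ⟨rfl, fun k hk => absurd (hi k) hk.ne⟩
  have hone : genMatrix 0 = 1 := rfl
  rw [bitLikelihood, hset, Finset.sum_singleton, hone, Matrix.vecMul_one]
  exact (Fin.prod_univ_one fun j => f j b).trans (by rw [hi 0])

theorem sum_prod_vecMul_genMatrix_succ (f : Fin (2 ^ (n + 1)) → ZMod 2 → R) (i : Fin (2 ^ n))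
    (c : Fin (2 ^ (n + 1)) → ZMod 2) (x y : ZMod 2) :
    ∑ u : Fin (2 ^ (n + 1)) → ZMod 2 with
        (u (consBit (0, i)) = x ∧ u (consBit (1, i)) = y) ∧
          ∀ k < i, ∀ a, u (consBit (a, k)) = c (consBit (a, k)),
        ∏ j, f j ((u ᵥ* genMatrix (n + 1)) j) =
      bitLikelihood (parityPart 0 f) i (parityPart 0 c + parityPart 1 c) (x + y) *
        bitLikelihood (parityPart 1 f) i (parityPart 1 c) y := by
  rw [bitLikelihood, bitLikelihood, Finset.sum_mul_sum, ← Finset.sum_product']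
  refine Finset.sum_equiv butterfly (fun u => ?_) fun u _ => ?_
  · have hpair {s t s' t' : ZMod 2} : s + t = s' + t' ∧ t = t' ↔ s = s' ∧ t = t' :=
      ⟨fun ⟨h, ht⟩ => ⟨by simpa [ht] using h, ht⟩, fun ⟨hs, ht⟩ => ⟨by rw [hs, ht], ht⟩⟩
    have hlist {p q r s : Prop} : (p ∧ q) ∧ r ∧ s ↔ (p ∧ r) ∧ q ∧ s := by tauto
    rw [butterfly_apply, Finset.mem_product, Finset.mem_filter_univ, Finset.mem_filter_univ,
      Finset.mem_filter_univ]
    simp only [Pi.add_apply, hlist, ← forall₂_and, hpair, parityPart, Fin.forall_fin_two]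
  · rw [prod_consBit, butterfly_apply, ← parityPart_zero_vecMul_genMatrix,
      ← parityPart_one_vecMul_genMatrix]
    rfl

theorem bitLikelihood_consBit_zero (f : Fin (2 ^ (n + 1)) → ZMod 2 → R) (i : Fin (2 ^ n))
    (c : Fin (2 ^ (n + 1)) → ZMod 2) (x : ZMod 2) :
    bitLikelihood f (consBit (0, i)) c x =
      ∑ y, bitLikelihood (parityPart 0 f) i (parityPart 0 c + parityPart 1 c) (x + y) *
        bitLikelihood (parityPart 1 f) i (parityPart 1 c) y := by
  rw [bitLikelihood, ← Finset.sum_fiberwise _ fun u => u (consBit (1, i))]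
  refine Finset.sum_congr rfl fun y _ => ?_
  rw [← sum_prod_vecMul_genMatrix_succ, Finset.filter_filter]
  refine Finset.sum_congr (Finset.filter_congr fun u _ => ?_) fun _ _ => rfl
  simp only [forall_consBit, consBit_lt_consBit_zero, Fin.forall_fin_two, ← forall₂_and]
  tauto

theorem bitLikelihood_consBit_one (f : Fin (2 ^ (n + 1)) → ZMod 2 → R) (i : Fin (2 ^ n))
    (c : Fin (2 ^ (n + 1)) → ZMod 2) (y : ZMod 2) :
    bitLikelihood f (consBit (1, i)) c y =
      bitLikelihood (parityPart 0 f) i (parityPart 0 c + parityPart 1 c)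
          (c (consBit (0, i)) + y) *
        bitLikelihood (parityPart 1 f) i (parityPart 1 c) y := by
  rw [← sum_prod_vecMul_genMatrix_succ, bitLikelihood]
  refine Finset.sum_congr (Finset.filter_congr fun u _ => ?_) fun _ _ => rfl
  simp only [forall_consBit, consBit_lt_consBit_one, Fin.forall_fin_two, forall_and, or_imp,
    true_and, forall_eq, one_ne_zero, false_and, or_false]
  tauto

theorem bitLikelihood_pos [PartialOrder R] [IsStrictOrderedRing R]
    {f : Fin (2 ^ n) → ZMod 2 → R} (hf : ∀ j x, 0 < f j x) (i : Fin (2 ^ n))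
    (c : Fin (2 ^ n) → ZMod 2) (b : ZMod 2) : 0 < bitLikelihood f i c b := by
  refine Finset.sum_pos (fun u _ => Finset.prod_pos fun j _ => hf j _) ?_
  refine ⟨Function.update c i b, Finset.mem_filter.2 ⟨Finset.mem_univ _, ?_, fun k hk => ?_⟩⟩
  · exact Function.update_self ..
  · exact Function.update_of_ne hk.ne ..

/-- The data bit `u i` is never visible through the received symbols and the previous data bits,
when the likelihoods of the code bit at position `j` range over the class `F j`. -/
def NoInfluence (F : Fin (2 ^ n) → Set (ZMod 2 → R)) (i : Fin (2 ^ n)) : Prop :=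
  ∀ f, (∀ j, f j ∈ F j) → ∀ c, bitLikelihood f i c 0 = bitLikelihood f i c 1

theorem noInfluence_zero {F : Fin (2 ^ 0) → Set (ZMod 2 → R)} {i : Fin (2 ^ 0)} :
    NoInfluence F i ↔ ∀ f ∈ F i, f 0 = f 1 := by
  simp only [NoInfluence, bitLikelihood_zero]
  refine ⟨fun h f hf => h (fun _ => f) (fun j => ?_) 0, fun h f hf _ => h _ (hf i)⟩
  rwa [Subsingleton.elim (α := Fin 1) j i]

end CommSemiring

section CommRing

variable [CommRing R]

theorem bitLikelihood_consBit_zero_sub (f : Fin (2 ^ (n + 1)) → ZMod 2 → R) (i : Fin (2 ^ n))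
    (c : Fin (2 ^ (n + 1)) → ZMod 2) :
    bitLikelihood f (consBit (0, i)) c 0 - bitLikelihood f (consBit (0, i)) c 1 =
      (bitLikelihood (parityPart 0 f) i (parityPart 0 c + parityPart 1 c) 0 -
          bitLikelihood (parityPart 0 f) i (parityPart 0 c + parityPart 1 c) 1) *
        (bitLikelihood (parityPart 1 f) i (parityPart 1 c) 0 -
          bitLikelihood (parityPart 1 f) i (parityPart 1 c) 1) := by
  simp only [bitLikelihood_consBit_zero, sum_zmod_two, add_zero, zero_add,
    CharTwo.add_self_eq_zero]
  ring

theorem noInfluence_consBit_zero [NoZeroDivisors R] {F : Fin (2 ^ (n + 1)) → Set (ZMod 2 → R)}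
    {i : Fin (2 ^ n)} :
    NoInfluence F (consBit (0, i)) ↔
      NoInfluence (parityPart 0 F) i ∨ NoInfluence (parityPart 1 F) i := by
  constructor
  · intro h
    by_contra! hinfl
    simp only [NoInfluence, not_forall, ← sub_ne_zero (b := bitLikelihood _ _ _ 1)] at hinfl
    obtain ⟨⟨f, hf, c, hfc⟩, g, hg, d, hgd⟩ := hinfl
    refine mul_ne_zero hfc hgd ?_
    have hprod := bitLikelihood_consBit_zero_sub (interleave ![f, g]) i (interleave ![c - d, d])
    simpa [h _ (interleave_mem hf hg)] using hprod.symm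
  · intro h f hf c
    rw [← sub_eq_zero, bitLikelihood_consBit_zero_sub, mul_eq_zero, sub_eq_zero, sub_eq_zero]
    exact h.imp (fun h => h _ (fun j => hf _) _) fun h => h _ (fun j => hf _) _

theorem NoInfluence.mul_eq_mul {F : Fin (2 ^ (n + 1)) → Set (ZMod 2 → R)} {i : Fin (2 ^ n)}
    (h : NoInfluence F (consBit (1, i))) {f g : Fin (2 ^ n) → ZMod 2 → R}
    (hf : ∀ j, f j ∈ parityPart 0 F j) (hg : ∀ j, g j ∈ parityPart 1 F j)
    (c d : Fin (2 ^ n) → ZMod 2) (z : ZMod 2) :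
    bitLikelihood f i c z * bitLikelihood g i d 0 =
      bitLikelihood f i c (z + 1) * bitLikelihood g i d 1 := by
  have hcongr : bitLikelihood f i (Function.update (c - d) i z + d) = bitLikelihood f i c :=
    bitLikelihood_congr f fun k hk => by simp [hk.ne]
  have hprod := h _ (interleave_mem hf hg) (interleave ![Function.update (c - d) i z, d])
  simpa [bitLikelihood_consBit_one, hcongr] using hprod

theorem eq_of_mul_eq_mul_swap [NoZeroDivisors R] {a b x y : R} (hab : a * x = b * y)
    (hba : b * x = a * y) (hxy : x + y ≠ 0) : a = b := by
  refine sub_eq_zero.1 ((mul_eq_zero.1 ?_).resolve_right hxy)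
  linear_combination hab - hba

theorem noInfluence_consBit_one [LinearOrder R] [IsStrictOrderedRing R]
    {F : Fin (2 ^ (n + 1)) → Set (ZMod 2 → R)} (hF : ∀ j, 1 ∈ F j) {i : Fin (2 ^ n)} :
    NoInfluence F (consBit (1, i)) ↔
      NoInfluence (parityPart 0 F) i ∧ NoInfluence (parityPart 1 F) i := by
  have hone : ∀ c : Fin (2 ^ n) → ZMod 2,
      bitLikelihood (1 : Fin (2 ^ n) → ZMod 2 → R) i c 0 + bitLikelihood 1 i c 1 ≠ 0 := fun c =>
    (add_pos (bitLikelihood_pos (fun _ _ => one_pos) i c 0)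
      (bitLikelihood_pos (fun _ _ => one_pos) i c 1)).ne'
  have htwo : (1 + 1 : ZMod 2) = 0 := CharTwo.add_self_eq_zero 1
  constructor
  · intro h
    refine ⟨fun f hf c => ?_, fun g hg d => ?_⟩
    · have hmul := h.mul_eq_mul hf (g := 1) (fun j => hF _) c c
      refine eq_of_mul_eq_mul_swap ?_ ?_ (hone c)
      · simpa using hmul 0
      · simpa [htwo] using hmul 1
    · have hmul := h.mul_eq_mul (f := 1) (fun j => hF _) hg d d
      refine eq_of_mul_eq_mul_swap ?_ ?_ (hone d)
      · simpa [mul_comm] using hmul 0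
      · simpa [htwo, mul_comm] using (hmul 1).symm
  · rintro ⟨heven, hodd⟩ f hf c
    have hswap := heven (parityPart 0 f) (fun j => hf _) (parityPart 0 c + parityPart 1 c)
    rw [bitLikelihood_consBit_one, bitLikelihood_consBit_one,
      hodd (parityPart 1 f) (fun j => hf _) (parityPart 1 c), add_zero]
    congr 1
    obtain hz | hz : c (consBit (0, i)) = 0 ∨ c (consBit (0, i)) = 1 := by
      generalize c (consBit (0, i)) = z
      decide +revert
    · simpa [hz] using hswap
    · simpa [hz, htwo] using hswap.symm

end CommRing

end Likelihood

/-! ### Extensionality of measures -/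

section MeasureExt

variable {α C ι : Type*} {X : ι → Type*} [MeasurableSpace α] [∀ j, MeasurableSpace (X j)]
  [MeasurableSpace C] [Countable C] [MeasurableSingletonClass C]

theorem measure_ext_prod_singleton {μ ν : Measure (α × C)}
    (h : ∀ s, MeasurableSet s → ∀ c, μ (s ×ˢ {c}) = ν (s ×ˢ {c})) : μ = ν := by
  ext s hs
  have hfiber (c : C) : MeasurableSet ((·, c) ⁻¹' s) := measurable_prodMk_right hs
  have hmeas (c : C) : MeasurableSet (((·, c) ⁻¹' s) ×ˢ ({c} : Set C)) :=
    (hfiber c).prod (measurableSet_singleton c)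
  have hunion : s = ⋃ c : C, ((·, c) ⁻¹' s) ×ˢ {c} := by
    ext ⟨a, c⟩
    simp
  have hdisj : Pairwise (Function.onFun Disjoint fun c : C => ((·, c) ⁻¹' s) ×ˢ {c}) :=
    fun c d hcd => Set.disjoint_prod.2 (Or.inr (Set.disjoint_singleton.2 hcd))
  rw [hunion, measure_iUnion hdisj hmeas, measure_iUnion hdisj hmeas]
  exact tsum_congr fun c => h _ (hfiber c) c

theorem measure_ext_pi_prod_singleton [Finite ι] {μ ν : Measure ((∀ j, X j) × C)}
    [IsFiniteMeasure μ]
    (h : ∀ A : ∀ j, Set (X j), (∀ j, MeasurableSet (A j)) →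
      ∀ c, μ (Set.univ.pi A ×ˢ {c}) = ν (Set.univ.pi A ×ˢ {c})) : μ = ν := by
  refine measure_ext_prod_singleton fun s hs c => ?_
  have hfst (ρ : Measure ((∀ j, X j) × C)) {t : Set (∀ j, X j)} (ht : MeasurableSet t) :
      (ρ.restrict (Prod.snd ⁻¹' {c})).fst t = ρ (t ×ˢ {c}) := by
    rw [Measure.fst_apply ht, Measure.restrict_apply (measurable_fst ht), Set.prod_eq]
  have hrect {A : ∀ j, Set (X j)} (hA : ∀ j, MeasurableSet (A j)) :
      (μ.restrict (Prod.snd ⁻¹' {c})).fst (Set.univ.pi A) =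
        (ν.restrict (Prod.snd ⁻¹' {c})).fst (Set.univ.pi A) := by
    rw [hfst μ (.univ_pi hA), hfst ν (.univ_pi hA), h A hA]
  have hslice : (μ.restrict (Prod.snd ⁻¹' {c})).fst = (ν.restrict (Prod.snd ⁻¹' {c})).fst := by
    refine ext_of_generate_finite _ generateFrom_pi.symm isPiSystem_pi ?_ ?_
    · rintro _ ⟨A, hA, rfl⟩
      exact hrect fun j => hA j (Set.mem_univ j)
    · rw [← Set.pi_univ Set.univ]
      exact hrect fun _ => .univ
  rw [← hfst μ hs, hslice, hfst ν hs]

end MeasureExt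

/-! ### Channels of capacity zero -/

section Channel

variable {Y : Type*} [MeasurableSpace Y]

theorem symCapacity_eq_zero_iff (W : ZMod 2 → Measure Y) [∀ x, IsFiniteMeasure (W x)] :
    symCapacity W = 0 ↔ W 0 = W 1 := by
  have : IsFiniteMeasure ((2⁻¹ : ℝ≥0∞) • (W 0 + W 1)) := Measure.smul_finite _ (by simp)
  have hcap : symCapacity W = 0 ↔
      W 0 = (2⁻¹ : ℝ≥0∞) • (W 0 + W 1) ∧ W 1 = (2⁻¹ : ℝ≥0∞) • (W 0 + W 1) := by
    simp [-smul_add, symCapacity, sum_zmod_two, ENNReal.div_eq_zero_iff,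
      InformationTheory.klDiv_eq_zero_iff]
  rw [hcap]
  refine ⟨fun h => h.1.trans h.2.symm, fun h => ?_⟩
  have hmean : (2⁻¹ : ℝ≥0∞) • (W 1 + W 1) = W 1 := by
    rw [← two_smul ℝ≥0∞ (W 1), smul_smul, ENNReal.inv_mul_cancel two_ne_zero (by simp), one_smul]
  rw [h, hmean, and_self]

/-- The probabilities of the output events of the channel `W`, as functions of the input bit. -/
def eventClass (W : ZMod 2 → Measure Y) : Set (ZMod 2 → ℝ) :=
  {f | ∃ A, MeasurableSet A ∧ (fun x => (W x).real A) = f}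

theorem one_mem_eventClass (W : ZMod 2 → Measure Y) [∀ x, IsProbabilityMeasure (W x)] :
    1 ∈ eventClass W :=
  ⟨Set.univ, .univ, funext fun _ => probReal_univ⟩

theorem forall_mem_eventClass_iff {W : ZMod 2 → Measure Y} [∀ x, IsFiniteMeasure (W x)] :
    (∀ f ∈ eventClass W, f 0 = f 1) ↔ W 0 = W 1 := by
  constructor
  · intro h
    ext A hA
    exact (measureReal_eq_measureReal_iff).1 (h _ ⟨A, hA, rfl⟩)
  · rintro h _ ⟨A, -, rfl⟩
    simp only [h]

theorem puncturedLaw_zero_eq_one_iff {W : ZMod 2 → Measure Y} (hW : W 0 ≠ W 1) {p : Bool} :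
    puncturedLaw W p 0 = puncturedLaw W p 1 ↔ p = true := by
  have hinl : MeasurableEmbedding (Sum.inl : Y → Y ⊕ Unit) :=
    ⟨Sum.inl_injective, measurable_inl, fun _ hs => hs.inl_image⟩
  cases p
  · simpa [puncturedLaw] using hinl.map_injective.ne hW
  · simp [puncturedLaw]

end Channel

/-! ### Virtual channels -/

section VirtualChannel

variable {Y : Type*} [MeasurableSpace Y] (W : ZMod 2 → Measure Y) [∀ x, IsProbabilityMeasure (W x)]
  {n : ℕ} (P : Pattern n) (i : Fin (2 ^ n))

instance isProbabilityMeasure_puncturedLaw (p : Bool) (x : ZMod 2) :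
    IsProbabilityMeasure (puncturedLaw W p x) := by
  unfold puncturedLaw
  split_ifs
  · infer_instance
  · exact Measure.isProbabilityMeasure_map measurable_inl.aemeasurable

instance isProbabilityMeasure_receivedLaw (u : Fin (2 ^ n) → ZMod 2) :
    IsProbabilityMeasure (receivedLaw W P u) := by
  unfold receivedLaw
  infer_instance

instance isFiniteMeasure_virtualChannel (b : ZMod 2) :
    IsFiniteMeasure (virtualChannel W P i b) :=
  Measure.smul_finite _ (ENNReal.inv_ne_top.2 (pow_ne_zero _ two_ne_zero))

theorem receivedLaw_prod_dirac_real (u c : Fin (2 ^ n) → ZMod 2)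
    (A : Fin (2 ^ n) → Set (Y ⊕ Unit)) :
    ((receivedLaw W P u).prod (Measure.dirac fun j : {j // j < i} => u j)).real
        (Set.univ.pi A ×ˢ {fun j : {j // j < i} => c j}) =
      if ∀ k < i, u k = c k then
        ∏ j, (puncturedLaw W (P j) ((u ᵥ* genMatrix n) j)).real (A j) else 0 := by
  have hmem : (fun j : {j // j < i} => u j) ∈
      ({fun j => c j.1} : Set ({j // j < i} → ZMod 2)) ↔ ∀ k < i, u k = c k := by
    simp [funext_iff]
  simp only [measureReal_def, Measure.prod_prod, receivedLaw, Measure.pi_pi, ENNReal.toReal_mul,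
    ENNReal.toReal_prod, Measure.dirac_apply, Set.indicator_apply, hmem]
  split_ifs <;> simp

theorem virtualChannel_real_pi_prod (b : ZMod 2) (c : Fin (2 ^ n) → ZMod 2)
    (A : Fin (2 ^ n) → Set (Y ⊕ Unit)) :
    (virtualChannel W P i b).real (Set.univ.pi A ×ˢ {fun j : {j // j < i} => c j}) =
      ((2 : ℝ) ^ (2 ^ n - 1))⁻¹ *
        bitLikelihood (fun j x => (puncturedLaw W (P j) x).real (A j)) i c b := by
  rw [virtualChannel, measureReal_ennreal_smul_apply, measureReal_def, Measure.finsetSum_apply,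
    ENNReal.toReal_sum fun _ _ => measure_ne_top _ _]
  congr 1
  · simp
  · rw [bitLikelihood, ← Finset.filter_filter,
      Finset.sum_filter fun u : Fin (2 ^ n) → ZMod 2 => ∀ k < i, u k = c k]
    exact Finset.sum_congr rfl fun u _ => receivedLaw_prod_dirac_real W P i u c A

theorem virtualChannel_zero_eq_one_iff :
    virtualChannel W P i 0 = virtualChannel W P i 1 ↔
      NoInfluence (fun j => eventClass (puncturedLaw W (P j))) i := by
  constructor
  · intro h f hf c
    choose A _ hA using hf
    obtain rfl : (fun j x => (puncturedLaw W (P j) x).real (A j)) = f := funext hA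
    have hpi := virtualChannel_real_pi_prod W P i 0 c A
    rw [h, virtualChannel_real_pi_prod] at hpi
    exact (mul_left_cancel₀ (by positivity) hpi).symm
  · intro h
    refine measure_ext_pi_prod_singleton fun A hA c => ?_
    obtain ⟨d, rfl⟩ : ∃ d : Fin (2 ^ n) → ZMod 2, (fun j : {j // j < i} => d j) = c :=
      ⟨fun j => if hj : j < i then c ⟨j, hj⟩ else 0, funext fun j => dif_pos j.2⟩
    refine (measureReal_eq_measureReal_iff).1 ?_
    rw [virtualChannel_real_pi_prod, virtualChannel_real_pi_prod, h _ fun j => ⟨A j, hA j, rfl⟩]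

theorem erasurePattern_eq_true_iff :
    erasurePattern W P i = true ↔ NoInfluence (fun j => eventClass (puncturedLaw W (P j))) i := by
  rw [erasurePattern, decide_eq_true_iff, symCapacity_eq_zero_iff, virtualChannel_zero_eq_one_iff]

end VirtualChannel

/-! ### Recursion for the erasure pattern -/

section ErasurePattern

variable {Y : Type*} [MeasurableSpace Y] {W : ZMod 2 → Measure Y} [∀ x, IsProbabilityMeasure (W x)]
  {n : ℕ}

theorem erasurePattern_zero (hW : 0 < symCapacity W) (P : Pattern 0) : erasurePattern W P = P := by
  have hne : W 0 ≠ W 1 := fun h => hW.ne' ((symCapacity_eq_zero_iff W).2 h)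
  funext i
  rw [Bool.eq_iff_iff, erasurePattern_eq_true_iff, noInfluence_zero, forall_mem_eventClass_iff,
    puncturedLaw_zero_eq_one_iff hne]

theorem parityPart_zero_erasurePattern (P : Pattern (n + 1)) :
    parityPart 0 (erasurePattern W P) =
      erasurePattern W (parityPart 0 P) ⊔ erasurePattern W (parityPart 1 P) := by
  funext i
  rw [parityPart, Bool.eq_iff_iff, Pi.sup_apply, Bool.max_eq_or, Bool.or_eq_true]
  simp only [erasurePattern_eq_true_iff]
  exact noInfluence_consBit_zero

theorem parityPart_one_erasurePattern (P : Pattern (n + 1)) :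
    parityPart 1 (erasurePattern W P) =
      erasurePattern W (parityPart 0 P) ⊓ erasurePattern W (parityPart 1 P) := by
  funext i
  rw [parityPart, Bool.eq_iff_iff, Pi.inf_apply, Bool.min_eq_and, Bool.and_eq_true]
  simp only [erasurePattern_eq_true_iff]
  exact noInfluence_consBit_one fun j => one_mem_eventClass _

theorem toNat_sup_add_toNat_inf (a b : Bool) :
    (a ⊔ b).toNat + (a ⊓ b).toNat = a.toNat + b.toNat := by
  decide +revert

theorem sum_toNat_erasurePattern (hW : 0 < symCapacity W) (P : Pattern n) :
    ∑ i, (erasurePattern W P i).toNat = ∑ i, (P i).toNat := by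
  induction n with
  | zero => rw [erasurePattern_zero hW]
  | succ n ih =>
    calc ∑ k, (erasurePattern W P k).toNat
        = ∑ i, ((parityPart 0 (erasurePattern W P) i).toNat +
            (parityPart 1 (erasurePattern W P) i).toNat) := by
          rw [sum_consBit, Finset.sum_add_distrib]
          rfl
      _ = ∑ i, (erasurePattern W (parityPart 0 P) i).toNat +
            ∑ i, (erasurePattern W (parityPart 1 P) i).toNat := by
          simp only [parityPart_zero_erasurePattern, parityPart_one_erasurePattern, Pi.sup_apply,
            Pi.inf_apply, toNat_sup_add_toNat_inf, Finset.sum_add_distrib]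
      _ = ∑ i, (parityPart 0 P i).toNat + ∑ i, (parityPart 1 P i).toNat := by rw [ih, ih]
      _ = ∑ k, (P k).toNat := (sum_consBit fun k => (P k).toNat).symm

theorem eq_of_le_of_sum_toNat_eq {ι : Type*} [Fintype ι] {A B : ι → Bool} (hle : A ≤ B)
    (hsum : ∑ i, (A i).toNat = ∑ i, (B i).toNat) : A = B := by
  have hterm := (Finset.sum_eq_sum_iff_of_le fun i _ => Bool.toNat_le_toNat (hle i)).1 hsum
  have hinj : Function.Injective Bool.toNat := Function.LeftInverse.injective Bool.ofNat_toNat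
  exact funext fun i => hinj (hterm i (Finset.mem_univ i))

end ErasurePattern

/-! ### Symmetric patterns -/

section Symmetric

variable {Y : Type*} [MeasurableSpace Y] {W : ZMod 2 → Measure Y} [∀ x, IsProbabilityMeasure (W x)]
  {n : ℕ}

theorem IsSymmetric.sup_eq {P : Pattern (n + 1)} (hP : IsSymmetric W P) :
    erasurePattern W (parityPart 0 P) ⊔ erasurePattern W (parityPart 1 P) = parityPart 0 P := by
  rw [← parityPart_zero_erasurePattern, hP]

theorem IsSymmetric.inf_eq {P : Pattern (n + 1)} (hP : IsSymmetric W P) :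
    erasurePattern W (parityPart 0 P) ⊓ erasurePattern W (parityPart 1 P) = parityPart 1 P := by
  rw [← parityPart_one_erasurePattern, hP]

theorem IsSymmetric.parityPart (hW : 0 < symCapacity W) {P : Pattern (n + 1)}
    (hP : IsSymmetric W P) (a : Fin 2) : IsSymmetric W (parityPart a P) := by
  have hsum := sum_toNat_erasurePattern hW (PolarCode.parityPart a P)
  fin_cases a
  · exact eq_of_le_of_sum_toNat_eq (le_sup_left.trans_eq hP.sup_eq) hsum
  · exact (eq_of_le_of_sum_toNat_eq (hP.inf_eq.symm.trans_le inf_le_right) hsum.symm).symm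

theorem IsSymmetric.parityPart_one_le {P : Pattern (n + 1)} (hP : IsSymmetric W P) :
    PolarCode.parityPart 1 P ≤ PolarCode.parityPart 0 P :=
  hP.inf_eq.symm.trans_le (inf_le_sup.trans_eq hP.sup_eq)

theorem IsSymmetric.isPrimitive (hW : 0 < symCapacity W) {P : Pattern n}
    (hP : IsSymmetric W P) : IsPrimitive P := by
  induction n with
  | zero => exact isPrimitive_iff_sortPattern_eq.2 rfl
  | succ n ih =>
    exact isPrimitive_of_parityPart (fun a => ih (hP.parityPart hW a)) hP.parityPart_one_le

end Symmetric

end PolarCode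

theorem mainTheorem6 {Y : Type*} [MeasurableSpace Y] (W : ZMod 2 → Measure Y)
    [∀ x, IsProbabilityMeasure (W x)] (hW : 0 < PolarCode.symCapacity W)
    (n : ℕ) (P : PolarCode.Pattern n) (hP : PolarCode.IsSymmetric W P) :
    PolarCode.IsPrimitive P ∧
      ∀ P' : PolarCode.Pattern n,
        PolarCode.Equivalent P P' → PolarCode.IsPrimitive P' → P' = P := by
  have hprim := hP.isPrimitive hW
  exact ⟨hprim, fun _ hE hP' => hprim.eq_of_equivalent hP' hE⟩
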